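/- Let $\mathcal F$ be the set of Möbius self-maps of $[0,1]$, i.e. of maps $f:[0,1]\to[0,1]$ of the form $f(x)=\frac{Ax+B}{Cx+D}$ with $A,B,C,D\in\mathbb R$ and $AD-BC\neq 0$ (the denominator having no zero in $[0,1]$). For $f\in\mathcal F$ let $o(f)$ denote the unique attracting fixed point of $f$, if it exists, where a fixed point $\theta\in[0,1]$ of $f$ is attracting if $f^n(x)\to\theta$ as $n\to\infty$ for all $x\in[0,1]$ sufficiently close to $\theta$; a statement involving $o(f)$ includes the claim that it exists. For $f,g\in\mathcal F$ and $x\in[0,1]$ let $\Omega_x=\{h(x): h\in\langle f,g\rangle\}$ be the orbit of $x$ under the semigroup $\langle f,g\rangle$ generated by $f$ and $g$ under composition, and write $fg=f\circ g$. Let $f,g\in\mathcal F$ be both decreasing, and let $x\in(0,1)$. Then $\Omega_x$ is dense in $[0,1]$ if and only if $\{o(fg),o(gf)\}=\{0,1\}$ and one of the following holds: (i) neither $f$ nor $g$ is onto $[0,1]$, and $\operatorname{Im}(f)\cup\operatorname{Im}(g)=[0,1]$; (ii) exactly one of $f$ and $g$ is onto $[0,1]$, and $\operatorname{Im}(fg)\cup\operatorname{Im}(gf)=[0,1]$.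 -/

import Mathlib

open Set Filter Topology

/-- `f : [0,1] → [0,1]` is a Möbius self-map: `f x = (A x + B) / (C x + D)` on `[0,1]` with
`A D - B C ≠ 0` (the denominator does not vanish on `[0,1]`). -/
def IsMobiusSelfMap (f : unitInterval → unitInterval) : Prop :=
  ∃ A B C D : ℝ, A * D - B * C ≠ 0 ∧
    ∀ x : unitInterval, C * (x : ℝ) + D ≠ 0 ∧
      ((f x : unitInterval) : ℝ) = (A * (x : ℝ) + B) / (C * (x : ℝ) + D)

/-- `θ ∈ [0,1]` is an attracting fixed point of `f`: it is fixed, and `f^n(x) → θ` as `n → ∞`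
for all `x ∈ [0,1]` near `θ`. -/
def IsAttractingFixedPoint (f : unitInterval → unitInterval) (θ : unitInterval) : Prop :=
  Function.IsFixedPt f θ ∧
    ∀ᶠ x in 𝓝 θ, Tendsto (fun n : ℕ => f^[n] x) atTop (𝓝 θ)

/-- `θ = o(f)`: the unique attracting fixed point of `f` exists and is `θ`. -/
def IsO (f : unitInterval → unitInterval) (θ : unitInterval) : Prop :=
  IsAttractingFixedPoint f θ ∧ ∀ η : unitInterval, IsAttractingFixedPoint f η → η = θ

/-- The semigroup `⟨f, g⟩` of self-maps of `[0,1]` generated by `f` and `g` under composition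
(multiplication in `Function.End` is composition). -/
def generatedSemigroup (f g : Function.End unitInterval) :
    Subsemigroup (Function.End unitInterval) :=
  Subsemigroup.closure {f, g}

/-- The orbit `Ω_x = {h(x) : h ∈ ⟨f, g⟩}`. -/
def semigroupOrbit (f g : unitInterval → unitInterval) (x : unitInterval) : Set unitInterval :=
  {y | ∃ h : unitInterval → unitInterval, h ∈ generatedSemigroup f g ∧ h x = y}

namespace MobiusOrbit

open scoped unitInterval

/-! In the coordinate `logit` the usual distance on the line is the hyperbolic (Hilbert) metric of
the open interval. A Möbius self-map never increases it, and strictly decreases it unless the map is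
onto (`dist_logit_of_lt`); a decreasing onto map is a reflection (`exists_reflection`).

Necessity. Apart from finitely many points a dense orbit lies in a closed union of images, which is
therefore everything. Covering both endpoints forces, up to exchanging the maps, `f 0 = 1` and `g 1
= 0`, so `f ∘ g` fixes 1 and `g ∘ f` fixes 0. An interior fixed point of `f ∘ g` would trap the
orbit in a bounded `logit` interval (`no_fixed_of_dense`), so these endpoints attract everything.
Two onto maps are two reflections, and an orbit under these is never dense.

Sufficiency (`eq_univ_of_invariant`). Let Λ be the closure of the orbit and suppose that it omits a
point. The preimage of a gap of Λ is again a gap, and strictly longer when the map is not onto. The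
covering hypothesis, with a point of Λ in the overlap of the images, puts every gap inside the image
of a map that is not onto, so no gap is longest. But iterates of `f ∘ g` and `g ∘ f` pull every gap
back to a fixed compact interval without shortening it, so a longest gap exists by compactness. -/

/-! ### The logit coordinate -/

lemma mem_Ioo_iff {y : I} : y ∈ Ioo (0 : I) 1 ↔ 0 < (y : ℝ) ∧ (y : ℝ) < 1 := Iff.rfl

/-- The coordinate `log (y / (1 - y))` on the open unit interval. -/
noncomputable def logit (y : I) : ℝ := Real.log y - Real.log (1 - y)

lemma logit_lt_logit {u v : I} (hu : u ∈ Ioo (0 : I) 1) (hv : v ∈ Ioo (0 : I) 1) (h : u < v) :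
    logit u < logit v := by
  rw [mem_Ioo_iff] at hu hv
  have h' : (u : ℝ) < v := h
  have h1 := Real.log_lt_log hu.1 h'
  have h2 : Real.log (1 - v) < Real.log (1 - u) :=
    Real.log_lt_log (by linarith [hv.2]) (by linarith)
  unfold logit
  linarith

lemma logit_le_logit {u v : I} (hu : u ∈ Ioo (0 : I) 1) (hv : v ∈ Ioo (0 : I) 1) (h : u ≤ v) :
    logit u ≤ logit v := by
  rcases h.eq_or_lt with rfl | h
  · exact le_rfl
  · exact (logit_lt_logit hu hv h).le

lemma continuousOn_logit : ContinuousOn logit (Ioo (0 : I) 1) := by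
  unfold logit
  refine ContinuousOn.sub (ContinuousOn.log (by fun_prop) ?_) (ContinuousOn.log (by fun_prop) ?_)
  · intro y hy; exact (mem_Ioo_iff.1 hy).1.ne'
  · intro y hy; exact (sub_pos.2 (mem_Ioo_iff.1 hy).2).ne'

lemma exists_logit_eq (s : ℝ) : ∃ y ∈ Ioo (0 : I) 1, logit y = s := by
  have he := Real.exp_pos s
  have h0 : 0 < Real.exp s / (1 + Real.exp s) := by positivity
  have h1 : Real.exp s / (1 + Real.exp s) < 1 := by
    rw [div_lt_one (by positivity)]; linarith
  refine ⟨⟨_, h0.le, h1.le⟩, mem_Ioo_iff.2 ⟨h0, h1⟩, ?_⟩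
  have h2 : 1 - Real.exp s / (1 + Real.exp s) = 1 / (1 + Real.exp s) := by
    field_simp; ring
  simp only [logit]
  rw [h2, Real.log_div he.ne' (by positivity), Real.log_div one_ne_zero (by positivity)]
  simp

/-! ### Möbius self-maps as contractions in the logit coordinate -/

/-- A Möbius self-map written with nonnegative coefficients in homogeneous coordinates. -/
lemma exists_nonneg_coeffs {f : I → I} (hf : IsMobiusSelfMap f) :
    ∃ α β γ δ : ℝ, 0 ≤ α ∧ 0 ≤ β ∧ 0 ≤ γ ∧ 0 ≤ δ ∧ α * δ - β * γ ≠ 0 ∧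
      ∀ y : I, 0 < (α + γ) * (y : ℝ) + (β + δ) * (1 - y) ∧
        (f y : ℝ) = (α * y + β * (1 - y)) / ((α + γ) * y + (β + δ) * (1 - y)) := by
  have key : ∀ A B C D : ℝ, 0 < D → A * D - B * C ≠ 0 →
      (∀ x : I, C * (x : ℝ) + D ≠ 0 ∧ (f x : ℝ) = (A * (x : ℝ) + B) / (C * (x : ℝ) + D)) →
      ∃ α β γ δ : ℝ, 0 ≤ α ∧ 0 ≤ β ∧ 0 ≤ γ ∧ 0 ≤ δ ∧ α * δ - β * γ ≠ 0 ∧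
      ∀ y : I, 0 < (α + γ) * (y : ℝ) + (β + δ) * (1 - y) ∧
        (f y : ℝ) = (α * y + β * (1 - y)) / ((α + γ) * y + (β + δ) * (1 - y)) := by
    intro A B C D hD hdet h
    -- Otherwise the zero of the denominator would lie in `[0,1]`.
    have hCD : 0 < C + D := by
      by_contra hneg
      have hC : 0 < -C := by linarith
      have hy : D / (-C) ≤ 1 := by rw [div_le_one hC]; linarith
      refine (h ⟨D / (-C), by positivity, hy⟩).1 ?_
      have hC' : C ≠ 0 := by linarith
      simp only [div_neg, mul_neg, mul_div_cancel₀ _ hC', neg_add_cancel]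
    have h0 := (h 0).2
    have h1 := (h 1).2
    simp only [Icc.coe_zero, mul_zero, zero_add, Icc.coe_one, mul_one] at h0 h1
    have b0 := (f 0).2.1
    have b1 := (f 0).2.2
    have c0 := (f 1).2.1
    have c1 := (f 1).2.2
    rw [h0] at b0 b1
    rw [h1] at c0 c1
    rw [div_le_one hD] at b1
    rw [div_le_one hCD] at c1
    have b0' : 0 ≤ B := by simpa [hD.ne'] using mul_nonneg b0 hD.le
    have c0' : 0 ≤ A + B := by
      have := mul_nonneg c0 hCD.le
      rwa [div_mul_cancel₀ _ hCD.ne'] at this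
    -- This is the matrix of `f` in the coordinates `[y : 1 - y]`. Its columns come from the values
    -- at 1 and 0, so nonnegativity says that these values lie in `[0,1]`.
    refine ⟨A + B, B, C + D - A - B, D - B, c0', b0', by linarith, by linarith, ?_, ?_⟩
    · intro e; apply hdet; linear_combination e
    · intro y
      have e1 : (A + B + (C + D - A - B)) * (y : ℝ) + (B + (D - B)) * (1 - y) = C * y + D := by ring
      have e2 : (A + B) * (y : ℝ) + B * (1 - y) = A * y + B := by ring
      rw [e1, e2]
      refine ⟨?_, (h y).2⟩
      have y0 := y.2.1
      have y1 := y.2.2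
      rcases y0.eq_or_lt with e | y0
      · rw [← e]; linarith
      · nlinarith [mul_pos hCD y0, mul_nonneg hD.le (sub_nonneg.2 y1)]
  obtain ⟨A, B, C, D, hdet, h⟩ := hf
  rcases lt_trichotomy D 0 with hD | hD | hD
  · refine key (-A) (-B) (-C) (-D) (by linarith) (fun e => hdet (by linear_combination e)) ?_
    intro x
    have e1 : -C * (x : ℝ) + -D = -(C * x + D) := by ring
    have e2 : -A * (x : ℝ) + -B = -(A * x + B) := by ring
    rw [e1, e2, neg_div_neg_eq]
    exact ⟨neg_ne_zero.2 (h x).1, (h x).2⟩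
  · exact absurd hD (by simpa using (h 0).1)
  · exact key A B C D hD hdet h

lemma continuous_of_mobius {f : I → I} (hf : IsMobiusSelfMap f) : Continuous f := by
  obtain ⟨A, B, C, D, -, h⟩ := hf
  rw [continuous_induced_rng]
  have e : (Subtype.val ∘ f) = fun x : I => (A * (x : ℝ) + B) / (C * (x : ℝ) + D) :=
    funext fun x => (h x).2
  rw [e]
  exact Continuous.div (by fun_prop) (by fun_prop) fun x => (h x).1

lemma numerator_pos {α β : ℝ} (hα : 0 ≤ α) (hβ : 0 ≤ β) (h : 0 < α ∨ 0 < β) {y : I}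
    (hy : y ∈ Ioo (0 : I) 1) : 0 < α * (y : ℝ) + β * (1 - y) := by
  rw [mem_Ioo_iff] at hy
  have h1 := sub_pos.2 hy.2
  have h0 := hy.1
  rcases h with h | h <;> positivity

lemma coeffs_pos {α β γ δ : ℝ} (hα : 0 ≤ α) (hβ : 0 ≤ β) (hγ : 0 ≤ γ) (hδ : 0 ≤ δ)
    (h : α * δ - β * γ ≠ 0) : (0 < α ∨ 0 < β) ∧ (0 < γ ∨ 0 < δ) := by
  constructor
  · by_contra! hc
    rw [le_antisymm hc.1 hα, le_antisymm hc.2 hβ] at h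
    simp at h
  · by_contra! hc
    rw [le_antisymm hc.1 hγ, le_antisymm hc.2 hδ] at h
    simp at h

lemma one_sub_value {α β γ δ : ℝ} {f : I → I} {y : I}
    (h : 0 < (α + γ) * (y : ℝ) + (β + δ) * (1 - y) ∧
      (f y : ℝ) = (α * y + β * (1 - y)) / ((α + γ) * y + (β + δ) * (1 - y))) :
    1 - (f y : ℝ) = (γ * y + δ * (1 - y)) / ((α + γ) * y + (β + δ) * (1 - y)) := by
  rw [h.2, eq_div_iff h.1.ne', sub_mul, div_mul_cancel₀ _ h.1.ne']
  ring

lemma mapsTo_interior {f : I → I} (hf : IsMobiusSelfMap f) {y : I} (hy : y ∈ Ioo (0 : I) 1) :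
    f y ∈ Ioo (0 : I) 1 := by
  obtain ⟨α, β, γ, δ, hα, hβ, hγ, hδ, hdet, h⟩ := exists_nonneg_coeffs hf
  obtain ⟨p, q⟩ := coeffs_pos hα hβ hγ hδ hdet
  rw [mem_Ioo_iff]
  constructor
  · rw [(h y).2]
    exact div_pos (numerator_pos hα hβ p hy) (h y).1
  · rw [← sub_pos, one_sub_value (h y)]
    exact div_pos (numerator_pos hγ hδ q hy) (h y).1

lemma logit_value {α β γ δ : ℝ} (hα : 0 ≤ α) (hβ : 0 ≤ β) (hγ : 0 ≤ γ) (hδ : 0 ≤ δ)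
    (hdet : α * δ - β * γ ≠ 0) {f : I → I} {y : I} (hy : y ∈ Ioo (0 : I) 1)
    (h : 0 < (α + γ) * (y : ℝ) + (β + δ) * (1 - y) ∧
      (f y : ℝ) = (α * y + β * (1 - y)) / ((α + γ) * y + (β + δ) * (1 - y))) :
    logit (f y) = Real.log (α * y + β * (1 - y)) - Real.log (γ * y + δ * (1 - y)) := by
  obtain ⟨p, q⟩ := coeffs_pos hα hβ hγ hδ hdet
  rw [logit, one_sub_value h, h.2, Real.log_div (numerator_pos hα hβ p hy).ne' h.1.ne',
    Real.log_div (numerator_pos hγ hδ q hy).ne' h.1.ne']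
  ring

lemma log_mul_four {a b c d : ℝ} (ha : 0 < a) (hb : 0 < b) (hc : 0 < c) (hd : 0 < d) :
    Real.log (a * b * (c * d)) = Real.log a + Real.log b + (Real.log c + Real.log d) := by
  rw [Real.log_mul (mul_pos ha hb).ne' (mul_pos hc hd).ne', Real.log_mul ha.ne' hb.ne',
    Real.log_mul hc.ne' hd.ne']

lemma surjective_of_endpoints {f : I → I} (hf : Continuous f)
    (h : (f 0 = 1 ∧ f 1 = 0) ∨ (f 0 = 0 ∧ f 1 = 1)) : Function.Surjective f := by
  intro y
  rcases h with ⟨h0, h1⟩ | ⟨h0, h1⟩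
  · exact mem_range_of_exists_le_of_exists_ge hf ⟨1, h1.trans_le y.2.1⟩ ⟨0, h0.symm ▸ y.2.2⟩
  · exact mem_range_of_exists_le_of_exists_ge hf ⟨0, h0.trans_le y.2.1⟩ ⟨1, h1.symm ▸ y.2.2⟩

/-- Möbius self-maps do not increase the distance in the `logit` coordinate, and those that are
not onto decrease it. -/
lemma dist_logit_of_lt {f : I → I} (hf : IsMobiusSelfMap f) {u v : I} (hu : u ∈ Ioo (0 : I) 1)
    (hv : v ∈ Ioo (0 : I) 1) (huv : u < v) :
    |logit (f u) - logit (f v)| ≤ logit v - logit u ∧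
      (¬ Function.Surjective f → |logit (f u) - logit (f v)| < logit v - logit u) := by
  have hcont := continuous_of_mobius hf
  obtain ⟨α, β, γ, δ, hα, hβ, hγ, hδ, hdet, h⟩ := exists_nonneg_coeffs hf
  obtain ⟨p, q⟩ := coeffs_pos hα hβ hγ hδ hdet
  rw [logit_value hα hβ hγ hδ hdet hu (h u), logit_value hα hβ hγ hδ hdet hv (h v)]
  have Nu := numerator_pos hα hβ p hu
  have Nv := numerator_pos hα hβ p hv
  have Mu := numerator_pos hγ hδ q hu
  have Mv := numerator_pos hγ hδ q hv
  -- If both products vanish, the nonzero determinant leaves only a diagonal or antidiagonal matrix,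
  -- and such a map permutes the endpoints.
  have hns : ¬ Function.Surjective f → 0 < α * γ ∨ 0 < β * δ := by
    intro hs
    by_contra! hc
    have h1 : α * γ = 0 := le_antisymm hc.1 (mul_nonneg hα hγ)
    have h2 : β * δ = 0 := le_antisymm hc.2 (mul_nonneg hβ hδ)
    have f0 := (h 0).2
    have f1 := (h 1).2
    have d0 := (h 0).1
    have d1 := (h 1).1
    simp only [Icc.coe_zero, mul_zero, zero_add, Icc.coe_one, mul_one, sub_zero, sub_self,
      add_zero] at f0 f1 d0 d1
    apply hs
    apply surjective_of_endpoints hcont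
    rcases mul_eq_zero.1 h1 with ha | hc'
    · rcases mul_eq_zero.1 h2 with hb | hd
      · exact absurd (by rw [ha, hb]; ring) hdet
      · left
        constructor <;> apply Subtype.ext
        · rw [f0, hd, add_zero, Icc.coe_one, div_self]; intro e; rw [e, hd] at d0; simp at d0
        · rw [f1, ha, zero_div, Icc.coe_zero]
    · rcases mul_eq_zero.1 h2 with hb | hd
      · right
        constructor <;> apply Subtype.ext
        · rw [f0, hb, zero_div, Icc.coe_zero]
        · rw [f1, hc', add_zero, Icc.coe_one, div_self]; intro e; rw [e, hc'] at d1; simp at d1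
      · exact absurd (by rw [hc', hd]; ring) hdet
  rw [mem_Ioo_iff] at hu hv
  have huv' : (u : ℝ) < v := huv
  unfold logit
  obtain ⟨a, ha⟩ : ∃ a : ℝ, a = u := ⟨_, rfl⟩
  obtain ⟨b, hb⟩ : ∃ b : ℝ, b = v := ⟨_, rfl⟩
  obtain ⟨a', ha'⟩ : ∃ a' : ℝ, a' = 1 - u := ⟨_, rfl⟩
  obtain ⟨b', hb'⟩ : ∃ b' : ℝ, b' = 1 - v := ⟨_, rfl⟩
  rw [← ha', ← ha, ← hb', ← hb]
  rw [← ha', ← ha] at Nu Mu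
  rw [← hb', ← hb] at Nv Mv
  rw [← ha] at hu huv' ha'
  rw [← hb] at hv huv' hb'
  have a0 := hu.1
  have b0 := hv.1
  have a1 : 0 < a' := by rw [ha']; exact sub_pos.2 hu.2
  have b1 : 0 < b' := by rw [hb']; exact sub_pos.2 hv.2
  have X : 0 < b * a' - a * b' := by
    have : b * a' - a * b' = b - a := by
      rw [ha', hb']; ring
    linarith
  -- After taking logarithms, `id1` bounds `logit (f v) - logit (f u)` and `id2` bounds its
  -- negative. The terms with `α * γ` and `β * δ` occur in both and give strictness.
  have id1 : (α * a + β * a') * (γ * b + δ * b') * (b * a') -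
      (α * b + β * b') * (γ * a + δ * a') * (a * b') =
      (b * a' - a * b') * (α * γ * (a * b) + β * δ * (a' * b') + β * γ * (a * b' + b * a')) := by
    ring
  have id2 : (α * b + β * b') * (γ * a + δ * a') * (b * a') -
      (α * a + β * a') * (γ * b + δ * b') * (a * b') =
      (b * a' - a * b') * (α * γ * (a * b) + β * δ * (a' * b') + α * δ * (a * b' + b * a')) := by
    ring
  have e1 := log_mul_four Nu Mv b0 a1
  have e2 := log_mul_four Nv Mu a0 b1
  have e3 := log_mul_four Nv Mu b0 a1
  have e4 := log_mul_four Nu Mv a0 b1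
  constructor
  · have p1 : 0 ≤ (b * a' - a * b') *
        (α * γ * (a * b) + β * δ * (a' * b') + β * γ * (a * b' + b * a')) := by positivity
    have p2 : 0 ≤ (b * a' - a * b') *
        (α * γ * (a * b) + β * δ * (a' * b') + α * δ * (a * b' + b * a')) := by positivity
    have l1 := Real.log_le_log (x := (α * b + β * b') * (γ * a + δ * a') * (a * b'))
      (by positivity) (sub_nonneg.1 (id1 ▸ p1))
    have l2 := Real.log_le_log (x := (α * a + β * a') * (γ * b + δ * b') * (a * b'))
      (by positivity) (sub_nonneg.1 (id2 ▸ p2))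
    rw [abs_le]
    constructor <;> linarith
  · intro hs
    have hpos : 0 < α * γ * (a * b) + β * δ * (a' * b') := by
      rcases hns hs with k | k <;> positivity
    have p1 : 0 < (b * a' - a * b') *
        (α * γ * (a * b) + β * δ * (a' * b') + β * γ * (a * b' + b * a')) := by positivity
    have p2 : 0 < (b * a' - a * b') *
        (α * γ * (a * b) + β * δ * (a' * b') + α * δ * (a * b' + b * a')) := by positivity
    have l1 := Real.log_lt_log (x := (α * b + β * b') * (γ * a + δ * a') * (a * b'))
      (by positivity) (sub_pos.1 (id1 ▸ p1))
    have l2 := Real.log_lt_log (x := (α * a + β * a') * (γ * b + δ * b') * (a * b'))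
      (by positivity) (sub_pos.1 (id2 ▸ p2))
    rw [abs_lt]
    constructor <;> linarith

lemma abs_logit_sub_le {f : I → I} (hf : IsMobiusSelfMap f) {u v : I} (hu : u ∈ Ioo (0 : I) 1)
    (hv : v ∈ Ioo (0 : I) 1) : |logit (f u) - logit (f v)| ≤ |logit u - logit v| := by
  rcases lt_trichotomy u v with h | rfl | h
  · exact (dist_logit_of_lt hf hu hv h).1.trans (neg_sub (logit u) _ ▸ neg_le_abs _)
  · simp
  · rw [abs_sub_comm]
    exact (dist_logit_of_lt hf hv hu h).1.trans (le_abs_self _)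

/-- A decreasing Möbius self-map onto `[0,1]` is a reflection in the `logit` coordinate. -/
lemma exists_reflection {f : I → I} (hf : IsMobiusSelfMap f) (h0 : f 0 = 1) (h1 : f 1 = 0) :
    (∃ s : ℝ, ∀ y ∈ Ioo (0 : I) 1, logit (f y) = s - logit y) ∧ ∀ y, f (f y) = y := by
  obtain ⟨α, β, γ, δ, hα, hβ, hγ, hδ, hdet, h⟩ := exists_nonneg_coeffs hf
  have f0 := one_sub_value (h 0)
  have f1 := (h 1).2
  have d0 := (h 0).1
  have d1 := (h 1).1
  simp only [h0, h1, Icc.coe_zero, mul_zero, zero_add, Icc.coe_one, mul_one, sub_zero, sub_self,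
      add_zero] at f0 f1 d0 d1
  have hδ0 : δ = 0 := by
    rcases div_eq_zero_iff.1 f0.symm with k | k
    · exact k
    · exact absurd k d0.ne'
  have hα0 : α = 0 := by
    rcases div_eq_zero_iff.1 f1.symm with k | k
    · exact k
    · exact absurd k d1.ne'
  subst hδ0 hα0
  have hb : 0 < β := by simpa using d0
  have hc : 0 < γ := by simpa using d1
  constructor
  · refine ⟨Real.log β - Real.log γ, fun y hy => ?_⟩
    rw [logit_value hα hβ hγ hδ hdet hy (h y), logit]
    rw [mem_Ioo_iff] at hy
    rw [zero_mul, zero_add, zero_mul, add_zero, Real.log_mul hb.ne' (sub_pos.2 hy.2).ne',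
      Real.log_mul hc.ne' hy.1.ne']
    ring
  · intro y
    apply Subtype.ext
    rw [(h (f y)).2, one_sub_value (h y), (h y).2]
    have := (h y).1
    simp only [zero_mul, zero_add, add_zero] at this ⊢
    field_simp
    rw [eq_comm]
    ring_nf

/-! ### Attraction to an endpoint -/

section Dynamics

variable {P : I → I}

lemma tendsto_iterate_one (hc : Continuous P) (hlt : ∀ y < 1, y < P y) (y : I) :
    Tendsto (fun n : ℕ => P^[n] y) atTop (𝓝 1) := by
  have hle : ∀ y, y ≤ P y := by
    intro y
    rcases (show y ≤ 1 from y.2.2).eq_or_lt with rfl | h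
    · by_contra! h
      have h2 := hlt _ h
      -- The inequality passes to the point 1 by continuity.
      have hmem : (1 : I) ∈ closure (Iio 1) := by
        rw [closure_Iio' (a := (1 : I)) ⟨0, zero_lt_one⟩]; exact self_mem_Iic
      have := closure_minimal (s := Iio (1 : I)) (t := {y | y ≤ P y}) (fun z hz => (hlt z hz).le)
        (isClosed_le continuous_id hc) hmem
      exact absurd this h.not_ge
    · exact (hlt y h).le
  have hmono : Monotone fun n : ℕ => P^[n] y := monotone_nat_of_le_succ fun n => by
    rw [Function.iterate_succ_apply']; exact hle _
  have hlim := tendsto_atTop_ciSup hmono ⟨1, by rintro _ ⟨n, rfl⟩; exact (P^[n] y).2.2⟩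
  have hfix := isFixedPt_of_tendsto_iterate hlim hc.continuousAt
  have h1 : (⨆ n : ℕ, P^[n] y) = 1 := by
    by_contra hne
    exact (hlt _ (lt_of_le_of_ne (show _ ≤ (1 : I) from unitInterval.le_one') hne)).ne' hfix
  rwa [h1] at hlim

lemma isO_one (hc : Continuous P) (hlt : ∀ y < 1, y < P y) (h1 : P 1 = 1) : IsO P 1 := by
  refine ⟨⟨h1, .of_forall (tendsto_iterate_one hc hlt)⟩, fun η hη => ?_⟩
  by_contra hne
  exact (hlt η (lt_of_le_of_ne η.2.2 hne)).ne' hη.1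

/-- By the intermediate value theorem, a failure at `y` would give a fixed point in `[0, y]`. -/
lemma lt_apply_of_no_fixed (hc : Continuous P) (h0 : P 0 ≠ 0)
    (hfix : ∀ y ∈ Ioo (0 : I) 1, P y ≠ y) : ∀ y < 1, y < P y := by
  intro y hy
  by_contra! hle
  obtain ⟨z, hz, e⟩ := isPreconnected_Icc.intermediate_value₂ (f := id) (g := P) (left_mem_Icc.2 (unitInterval.nonneg' : 0 ≤ y))
    (right_mem_Icc.2 unitInterval.nonneg') continuousOn_id hc.continuousOn
    unitInterval.nonneg' hle
  rcases (show 0 ≤ z from hz.1).eq_or_lt with rfl | h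
  · exact h0 e.symm
  · exact hfix z ⟨h, hz.2.trans_lt hy⟩ e.symm

lemma tendsto_iterate_zero (hc : Continuous P) (hlt : ∀ y > 0, P y < y) (y : I) :
    Tendsto (fun n : ℕ => P^[n] y) atTop (𝓝 0) := by
  -- Conjugation by `y ↦ 1 - y` exchanges the two endpoints.
  let Q : I → I := fun z => unitInterval.symm (P (unitInterval.symm z))
  have hQ : ∀ n : ℕ, ∀ z, Q^[n] (unitInterval.symm z) = unitInterval.symm (P^[n] z) := by
    intro n
    induction n with
    | zero => intro z; rfl
    | succ n ih => intro z; simp only [Function.iterate_succ_apply]; rw [← ih]; simp [Q]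
  have := tendsto_iterate_one (P := Q) (by fun_prop) (fun z hz => by
    have := hlt (unitInterval.symm z) (by rwa [gt_iff_lt, unitInterval.pos_iff_ne_zero,
      Ne, unitInterval.symm_eq_zero, ← Ne, ← unitInterval.lt_one_iff_ne_one])
    rw [← unitInterval.symm_lt_symm, unitInterval.symm_symm]
    exact this) (unitInterval.symm y)
  simp only [hQ] at this
  have h2 := (unitInterval.continuous_symm.tendsto 1).comp this
  simpa [Function.comp_def] using h2

lemma isO_zero (hc : Continuous P) (hlt : ∀ y > 0, P y < y) (h0 : P 0 = 0) : IsO P 0 := by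
  refine ⟨⟨h0, .of_forall (tendsto_iterate_zero hc hlt)⟩, fun η hη => ?_⟩
  by_contra hne
  exact (hlt η (unitInterval.pos_iff_ne_zero.2 hne)).ne hη.1

lemma apply_lt_of_no_fixed (hc : Continuous P) (h1 : P 1 ≠ 1)
    (hfix : ∀ y ∈ Ioo (0 : I) 1, P y ≠ y) : ∀ y > 0, P y < y := by
  intro y hy
  by_contra! hle
  obtain ⟨z, hz, e⟩ := isPreconnected_Icc.intermediate_value₂ (f := id) (g := P) (left_mem_Icc.2 (unitInterval.le_one' : y ≤ 1))
    (right_mem_Icc.2 unitInterval.le_one') continuousOn_id hc.continuousOn hle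
    unitInterval.le_one'
  rcases (show z ≤ 1 from hz.2).eq_or_lt with rfl | h
  · exact h1 e.symm
  · exact hfix z ⟨hy.trans_le hz.1, h⟩ e.symm

end Dynamics

/-! ### Obstructions to a dense orbit -/

section Orbit

variable {f g : I → I} {x : I}

lemma semigroupOrbit_subset {S : Set I} (hf : MapsTo f S S) (hg : MapsTo g S S) (hx : x ∈ S) :
    semigroupOrbit f g x ⊆ S := by
  rintro y ⟨h, hh, rfl⟩
  have : MapsTo h S S := by
    refine Subsemigroup.closure_induction (s := ({f, g} : Set (Function.End I))) (p := fun h _ => MapsTo (h : I → I) S S) ?_ ?_ hh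
    · rintro k (rfl | rfl)
      · exact hf
      · exact hg
    · intro a b _ _ ha hb
      exact MapsTo.comp ha hb
  exact this hx

lemma left_apply_mem_semigroupOrbit : f x ∈ semigroupOrbit f g x :=
  ⟨f, Subsemigroup.subset_closure (mem_insert _ _), rfl⟩

lemma semigroupOrbit_comm : semigroupOrbit f g x = semigroupOrbit g f x := by
  have : generatedSemigroup f g = generatedSemigroup g f := by
    exact congrArg _ (pair_comm (α := Function.End I) f g)
  unfold semigroupOrbit
  rw [this]

lemma mapsTo_left_semigroupOrbit :
    MapsTo f (semigroupOrbit f g x) (semigroupOrbit f g x) := by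
  rintro y ⟨h, hh, rfl⟩
  exact ⟨f ∘ h, Subsemigroup.mul_mem (generatedSemigroup f g)
    (Subsemigroup.subset_closure (mem_insert _ _)) hh, rfl⟩

lemma mapsTo_right_semigroupOrbit :
    MapsTo g (semigroupOrbit f g x) (semigroupOrbit f g x) := by
  rw [semigroupOrbit_comm]
  exact mapsTo_left_semigroupOrbit

/-- A closed set of `logit` values invariant under both maps contains every value as soon as
some orbit starting in it is dense. -/
lemma eq_univ_of_dense_of_logit {A : Set ℝ} (hA : IsClosed A) (hf : IsMobiusSelfMap f)
    (hg : IsMobiusSelfMap g)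
    (hfA : ∀ y ∈ Ioo (0 : I) 1, logit y ∈ A → logit (f y) ∈ A)
    (hgA : ∀ y ∈ Ioo (0 : I) 1, logit y ∈ A → logit (g y) ∈ A)
    (hx : x ∈ Ioo (0 : I) 1) (hxA : logit x ∈ A) (hd : Dense (semigroupOrbit f g x)) :
    A = univ := by
  rw [eq_univ_iff_forall]
  by_contra! hs
  obtain ⟨s, hs⟩ := hs
  have hV : IsOpen (Ioo (0 : I) 1 ∩ logit ⁻¹' Aᶜ) :=
    continuousOn_logit.isOpen_inter_preimage isOpen_Ioo hA.isOpen_compl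
  obtain ⟨y, hy, rfl⟩ := exists_logit_eq s
  obtain ⟨z, hz, hzV⟩ := hd.exists_mem_open hV ⟨y, hy, hs⟩
  have := semigroupOrbit_subset (f := f) (g := g) (x := x)
    (S := {y | y ∈ Ioo (0 : I) 1 ∧ logit y ∈ A})
    (fun y hy => ⟨mapsTo_interior hf hy.1, hfA y hy.1 hy.2⟩)
    (fun y hy => ⟨mapsTo_interior hg hy.1, hgA y hy.1 hy.2⟩) ⟨hx, hxA⟩ hz
  exact hzV.2 this.2

/-- The interval has no isolated points, so deleting finitely many points from a dense set leaves it
dense. -/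
lemma eq_univ_of_dense_of_finite {Q t : Set I} (hQ : IsClosed Q) (ht : t.Finite)
    (hf : MapsTo f (Q ∪ t) (Q ∪ t)) (hg : MapsTo g (Q ∪ t) (Q ∪ t)) (hx : x ∈ Q ∪ t)
    (hd : Dense (semigroupOrbit f g x)) : Q = univ := by
  have h1 : Dense (Q ∪ t) := hd.mono (semigroupOrbit_subset hf hg hx)
  have h2 := h1.sdiff_finite ht
  have h3 : Dense Q := h2.mono fun y hy => hy.1.resolve_right hy.2
  rw [← hQ.closure_eq, h3.closure_eq]

/-- The `logit` interval of radius `R` about the midpoint of `u` and `w` is invariant. Since `f`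
reverses order, `f y` lies on the opposite side of `u` from that of `y` relative to `w`, and no
farther away; the bound on one side then comes from contraction and on the other from `u` itself
lying in the interval. -/
lemma logit_invariant_of_swap (hf : IsMobiusSelfMap f) (hf_dec : StrictAnti f) {u w : I}
    (hu : u ∈ Ioo (0 : I) 1) (hw : w ∈ Ioo (0 : I) 1) (hfw : f w = u) {R : ℝ} {y : I}
    (hy : y ∈ Ioo (0 : I) 1) (hR : |logit u - logit w| ≤ 2 * R)
    (hyR : |2 * logit y - (logit u + logit w)| ≤ 2 * R) :
    |2 * logit (f y) - (logit u + logit w)| ≤ 2 * R := by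
  have hfy := mapsTo_interior hf hy
  have hc := abs_logit_sub_le hf hy hw
  rw [hfw] at hc
  rw [abs_le] at hR hyR hc ⊢
  rcases le_total y w with h | h
  · have h1 := logit_le_logit hy hw h
    have h2 := hf_dec.antitone h
    rw [hfw] at h2
    have h3 := logit_le_logit hu hfy h2
    rw [abs_of_nonpos (by linarith)] at hc
    constructor <;> linarith
  · have h1 := logit_le_logit hw hy h
    have h2 := hf_dec.antitone h
    rw [hfw] at h2
    have h3 := logit_le_logit hfy hu h2
    rw [abs_of_nonneg (by linarith)] at hc
    constructor <;> linarith

/-- If `f (g u) = u`, put `w = g u`: then `g` sends `u` to `w` and `f` sends `w` to `u`, so both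
maps preserve every large enough `logit` interval centred midway between them. -/
lemma no_fixed_of_dense (hf : IsMobiusSelfMap f) (hg : IsMobiusSelfMap g)
    (hf_dec : StrictAnti f) (hg_dec : StrictAnti g) (hx : x ∈ Ioo (0 : I) 1)
    (hd : Dense (semigroupOrbit f g x)) : ∀ u ∈ Ioo (0 : I) 1, (f ∘ g) u ≠ u := by
  intro u hu hfix
  have hw := mapsTo_interior hg hu
  obtain ⟨w, hgw⟩ : ∃ w, g u = w := ⟨_, rfl⟩
  rw [Function.comp_apply, hgw] at hfix
  rw [hgw] at hw
  obtain ⟨R, hR1, hR2⟩ : ∃ R : ℝ, |logit u - logit w| ≤ 2 * R ∧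
      |2 * logit x - (logit u + logit w)| ≤ 2 * R :=
    ⟨max |logit u - logit w| |2 * logit x - (logit u + logit w)| / 2, by
      rw [mul_div_cancel₀ _ two_ne_zero]; exact le_max_left _ _, by
      rw [mul_div_cancel₀ _ two_ne_zero]; exact le_max_right _ _⟩
  have hA := eq_univ_of_dense_of_logit
    (A := {s : ℝ | |2 * s - (logit u + logit w)| ≤ 2 * R})
    (isClosed_le (by fun_prop) continuous_const) hf hg
    (fun y hy h => logit_invariant_of_swap hf hf_dec hu hw hfix hy hR1 h)
    (fun y hy h => by
      rw [mem_ofPred_eq, add_comm] at h ⊢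
      exact logit_invariant_of_swap hg hg_dec hw hu hgw hy (by rwa [abs_sub_comm]) h)
    hx hR2 hd
  have := hA ▸ mem_univ ((logit u + logit w) / 2 + R + 1)
  rw [mem_ofPred_eq, abs_le] at this
  linarith [this.2]

/-- Both maps are reflections of the line, and a nonconstant continuous function invariant under
both separates the orbit from other points. -/
lemma not_dense_of_onto (hf : IsMobiusSelfMap f) (hg : IsMobiusSelfMap g) (f0 : f 0 = 1)
    (f1 : f 1 = 0) (g0 : g 0 = 1) (g1 : g 1 = 0) (hx : x ∈ Ioo (0 : I) 1) :
    ¬ Dense (semigroupOrbit f g x) := by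
  intro hd
  obtain ⟨⟨s, hs⟩, -⟩ := exists_reflection hf f0 f1
  obtain ⟨⟨t, ht⟩, -⟩ := exists_reflection hg g0 g1
  have key : ∀ p : ℝ → ℝ, Continuous p → (∀ z, p (s - z) = p z) → (∀ z, p (t - z) = p z) →
      ∀ a b, p a = p b := by
    intro p hp h1 h2
    have hA := eq_univ_of_dense_of_logit (A := {z | p z = p (logit x)})
      (isClosed_eq hp continuous_const) hf hg
      (fun y hy h => by rw [mem_ofPred_eq, hs y hy, h1]; exact h)
      (fun y hy h => by rw [mem_ofPred_eq, ht y hy, h2]; exact h) hx rfl hd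
    intro a b
    have ha := hA ▸ mem_univ a
    have hb := hA ▸ mem_univ b
    exact Eq.trans ha (Eq.symm hb)
  by_cases hst : s = t
  · subst hst
    have := key (fun z => (2 * z - s) ^ 2) (by fun_prop) (fun z => by ring) (fun z => by ring)
      (s / 2) (s / 2 + 1)
    ring_nf at this
    norm_num at this
  · have hne : s - t ≠ 0 := sub_ne_zero.2 hst
    -- The cosine is even about `s / 2` and has period `s - t`, the translation composed from the
    -- two reflections.
    have := key (fun z => Real.cos (Real.pi * (2 * z - s) / (s - t))) (by fun_prop)
      (fun z => by rw [← Real.cos_neg]; congr 1; ring)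
      (fun z => by
        rw [← Real.cos_neg, ← Real.cos_sub_two_pi]; congr 1; field_simp; ring)
      (s / 2) (s / 2 + (s - t) / 2)
    have e1 : Real.pi * (2 * (s / 2) - s) / (s - t) = 0 := by ring
    have e2 : Real.pi * (2 * (s / 2 + (s - t) / 2) - s) / (s - t) = Real.pi := by
      field_simp; ring
    simp only [e1, e2, Real.cos_zero, Real.cos_pi] at this
    norm_num at this

end Orbit

/-! ### Endpoint values of decreasing maps -/

section Endpoints

variable {f : I → I}

lemma apply_zero_eq_one_of_mem_range (hf : StrictAnti f) (h : 1 ∈ range f) : f 0 = 1 := by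
  obtain ⟨y, hy⟩ := h
  have := hf.antitone (show 0 ≤ y from y.2.1)
  rw [hy] at this
  exact le_antisymm (f 0).2.2 this

lemma apply_one_eq_zero_of_mem_range (hf : StrictAnti f) (h : 0 ∈ range f) : f 1 = 0 := by
  obtain ⟨y, hy⟩ := h
  have := hf.antitone (show y ≤ 1 from y.2.2)
  rw [hy] at this
  exact le_antisymm this (f 1).2.1

lemma surjective_iff (hc : Continuous f) (hf : StrictAnti f) :
    Function.Surjective f ↔ f 0 = 1 ∧ f 1 = 0 :=
  ⟨fun h => ⟨apply_zero_eq_one_of_mem_range hf (h 1), apply_one_eq_zero_of_mem_range hf (h 0)⟩,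
    fun h => surjective_of_endpoints hc (Or.inl h)⟩

end Endpoints

/-! ### Gaps of an invariant closed set -/

/-- No point of `Λ` lies strictly between `u` and `v`. -/
def IsGap (Λ : Set I) (u v : I) : Prop := ∀ z ∈ Λ, z ≤ u ∨ v ≤ z

variable {Λ : Set I}

/-- The endpoints of a gap need not belong to Λ, so forward invariance is enough: a point of Λ
strictly between the preimages would be mapped into the original gap. -/
lemma exists_gap_preimage {h : I → I} (hm : StrictMono h ∨ StrictAnti h) (hΛ : MapsTo h Λ Λ)
    {u v : I} (huv : u < v) (hgap : IsGap Λ u v) (hu : u ∈ range h) (hv : v ∈ range h) :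
    ∃ u' v', u' < v' ∧ IsGap Λ u' v' ∧ ((h u' = u ∧ h v' = v) ∨ (h u' = v ∧ h v' = u)) := by
  obtain ⟨u, rfl⟩ := hu
  obtain ⟨v, rfl⟩ := hv
  rcases hm with hm | hm
  · exact ⟨u, v, hm.lt_iff_lt.1 huv, fun z hz => (hgap _ (hΛ hz)).imp hm.le_iff_le.1
      hm.le_iff_le.1, Or.inl ⟨rfl, rfl⟩⟩
  · exact ⟨v, u, hm.lt_iff_gt.1 huv, fun z hz => (hgap _ (hΛ hz)).symm.imp hm.le_iff_ge.1
      hm.le_iff_ge.1, Or.inr ⟨rfl, rfl⟩⟩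

lemma logit_gap_preimage {h : I → I} (hh : IsMobiusSelfMap h) {u v u' v' : I}
    (huv : u < v) (hlt : u' < v') (hu' : u' ∈ Ioo (0 : I) 1) (hv' : v' ∈ Ioo (0 : I) 1)
    (e : (h u' = u ∧ h v' = v) ∨ (h u' = v ∧ h v' = u)) :
    logit v - logit u ≤ logit v' - logit u' ∧
      (¬ Function.Surjective h → logit v - logit u < logit v' - logit u') := by
  have key := dist_logit_of_lt hh hu' hv' hlt
  have hu1 := mapsTo_interior hh hu'
  have hv1 := mapsTo_interior hh hv'
  have hle : logit v - logit u ≤ |logit (h u') - logit (h v')| := by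
    rcases e with ⟨rfl, rfl⟩ | ⟨rfl, rfl⟩
    · rw [abs_sub_comm]; exact le_abs_self _
    · exact le_abs_self _
  exact ⟨hle.trans key.1, fun hs => hle.trans_lt (key.2 hs)⟩

lemma iterate_mem {P : I → I} (hP : IsMobiusSelfMap P) (hΛ : MapsTo P Λ Λ) {x : I}
    (hx : x ∈ Ioo (0 : I) 1) (hxΛ : x ∈ Λ) (n : ℕ) : P^[n] x ∈ Ioo (0 : I) 1 ∧ P^[n] x ∈ Λ :=
  ⟨MapsTo.iterate (fun _ hy => mapsTo_interior hP hy) n hx, hΛ.iterate n hxΛ⟩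

/-- A gap close to `1` has a preimage gap, under iterates of `F`, that meets `[c, d]`. -/
lemma exists_gap_pull_left {F : I → I} (hF : IsMobiusSelfMap F) (hFm : StrictMono F)
    (hFΛ : MapsTo F Λ Λ) (hlt : ∀ y < 1, y < F y)
    (hint : ∀ u v, u < v → IsGap Λ u v → u ∈ Ioo (0 : I) 1 ∧ v ∈ Ioo (0 : I) 1)
    {c d : I} (hc : F c ≤ d) {u v : I} (huv : u < v) (hgap : IsGap Λ u v) (hu : d < u) :
    ∃ u' v', u' < v' ∧ IsGap Λ u' v' ∧ u' ≤ d ∧ c ≤ v' ∧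
      logit v - logit u ≤ logit v' - logit u' := by
  have hcont := continuous_of_mobius hF
  -- The index bounds the number of pull-backs: each one removes an `F` from `u ≤ F^[n] d`, and the
  -- case 0 contradicts `d < u`.
  have main : ∀ n : ℕ, ∀ u v, u < v → IsGap Λ u v → d < u → u ≤ F^[n] d →
      ∃ u' v', u' < v' ∧ IsGap Λ u' v' ∧ u' ≤ d ∧ c ≤ v' ∧
        logit v - logit u ≤ logit v' - logit u' := by
    intro n
    induction n with
    | zero => intro u v _ _ h1 h2; exact absurd h2 h1.not_ge
    | succ n ih =>
      intro u v huv hgap hdu hun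
      have F1 : F 1 = 1 := by
        have := tendsto_iterate_one hcont hlt 1
        exact isFixedPt_of_tendsto_iterate this hcont.continuousAt
      have hr : ∀ y, d < y → y ∈ range F := fun y hy =>
        mem_range_of_exists_le_of_exists_ge hcont ⟨c, hc.trans hy.le⟩ ⟨1, F1.symm ▸ y.2.2⟩
      obtain ⟨u1, v1, h1, g1, e⟩ := exists_gap_preimage (Or.inl hFm) hFΛ huv hgap (hr u hdu)
        (hr v (hdu.trans huv))
      obtain ⟨iu, iv⟩ := hint u1 v1 h1 g1
      have hl := (logit_gap_preimage hF huv h1 iu iv e).1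
      have e' : F u1 = u ∧ F v1 = v := e.resolve_right fun ⟨a, b⟩ =>
        (hFm h1).not_gt (by rw [a, b]; exact huv)
      by_cases hd : d < u1
      · have : u1 ≤ F^[n] d := by
          rw [Function.iterate_succ_apply', ← e'.1] at hun
          exact hFm.le_iff_le.1 hun
        obtain ⟨u', v', k1, k2, k3, k4, k5⟩ := ih u1 v1 h1 g1 hd this
        exact ⟨u', v', k1, k2, k3, k4, hl.trans k5⟩
      -- The pull-back cannot jump past `[c, d]`, because `F c ≤ d < F v1`.
      · refine ⟨u1, v1, h1, g1, not_lt.1 hd, ?_, hl⟩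
        have : F c < F v1 := by rw [e'.2]; exact hc.trans_lt (hdu.trans huv)
        exact (hFm.lt_iff_lt.1 this).le
  have hlim := tendsto_iterate_one hcont hlt d
  obtain ⟨n, hn⟩ := (hlim.eventually_const_lt (hint u v huv hgap).1.2).exists
  exact main n u v huv hgap hu hn.le

/-- A gap close to `0` has a preimage gap, under iterates of `G`, that meets `[c, d]`. -/
lemma exists_gap_pull_right {G : I → I} (hG : IsMobiusSelfMap G) (hGm : StrictMono G)
    (hGΛ : MapsTo G Λ Λ) (hlt : ∀ y > 0, G y < y)
    (hint : ∀ u v, u < v → IsGap Λ u v → u ∈ Ioo (0 : I) 1 ∧ v ∈ Ioo (0 : I) 1)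
    {c d : I} (hd : c ≤ G d) {u v : I} (huv : u < v) (hgap : IsGap Λ u v) (hv : v < c) :
    ∃ u' v', u' < v' ∧ IsGap Λ u' v' ∧ u' ≤ d ∧ c ≤ v' ∧
      logit v - logit u ≤ logit v' - logit u' := by
  have hcont := continuous_of_mobius hG
  have main : ∀ n : ℕ, ∀ u v, u < v → IsGap Λ u v → v < c → G^[n] c ≤ v →
      ∃ u' v', u' < v' ∧ IsGap Λ u' v' ∧ u' ≤ d ∧ c ≤ v' ∧
        logit v - logit u ≤ logit v' - logit u' := by
    intro n
    induction n with
    | zero => intro u v _ _ h1 h2; exact absurd h2 h1.not_ge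
    | succ n ih =>
      intro u v huv hgap hvc hun
      have G0 : G 0 = 0 := by
        have := tendsto_iterate_zero hcont hlt 0
        exact isFixedPt_of_tendsto_iterate this hcont.continuousAt
      have hr : ∀ y, y < c → y ∈ range G := fun y hy =>
        mem_range_of_exists_le_of_exists_ge hcont ⟨0, G0.symm ▸ y.2.1⟩ ⟨d, hy.le.trans hd⟩
      obtain ⟨u1, v1, h1, g1, e⟩ := exists_gap_preimage (Or.inl hGm) hGΛ huv hgap
        (hr u (huv.trans hvc)) (hr v hvc)
      obtain ⟨iu, iv⟩ := hint u1 v1 h1 g1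
      have hl := (logit_gap_preimage hG huv h1 iu iv e).1
      have e' : G u1 = u ∧ G v1 = v := e.resolve_right fun ⟨a, b⟩ =>
        (hGm h1).not_gt (by rw [a, b]; exact huv)
      by_cases hd' : v1 < c
      · have : G^[n] c ≤ v1 := by
          rw [Function.iterate_succ_apply', ← e'.2] at hun
          exact hGm.le_iff_le.1 hun
        obtain ⟨u', v', k1, k2, k3, k4, k5⟩ := ih u1 v1 h1 g1 hd' this
        exact ⟨u', v', k1, k2, k3, k4, hl.trans k5⟩
      · refine ⟨u1, v1, h1, g1, ?_, not_lt.1 hd', hl⟩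
        have : G u1 < G d := by rw [e'.1]; exact (huv.trans hvc).trans_le hd
        exact (hGm.lt_iff_lt.1 this).le
  have hlim := tendsto_iterate_zero hcont hlt c
  obtain ⟨n, hn⟩ := (hlim.eventually_lt_const (hint u v huv hgap).2.1).exists
  exact main n u v huv hgap hv hn.le

/-- A closed set invariant under two Möbius maps that are not onto and whose images cover `[0,1]`,
and under Möbius maps attracting everything to `1` and to `0`, is all of `[0,1]`. -/
theorem eq_univ_of_invariant (hΛ : IsClosed Λ) {φ ψ F G : I → I} (hφ : IsMobiusSelfMap φ)
    (hψ : IsMobiusSelfMap ψ) (hF : IsMobiusSelfMap F) (hG : IsMobiusSelfMap G)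
    (φΛ : MapsTo φ Λ Λ) (ψΛ : MapsTo ψ Λ Λ) (FΛ : MapsTo F Λ Λ) (GΛ : MapsTo G Λ Λ)
    (φm : StrictMono φ ∨ StrictAnti φ) (ψm : StrictMono ψ ∨ StrictAnti ψ)
    (Fm : StrictMono F) (Gm : StrictMono G) (φs : ¬ Function.Surjective φ)
    (ψs : ¬ Function.Surjective ψ) {b : I} (hb : b ∈ Λ) (φr : Ici b ⊆ range φ)
    (ψr : Iic b ⊆ range ψ) (Flt : ∀ y < 1, y < F y) (Glt : ∀ y > 0, G y < y) {x : I}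
    (hx : x ∈ Ioo (0 : I) 1) (hxΛ : x ∈ Λ) : Λ = univ := by
  -- Iterates of `F` and `G` make Λ accumulate at both endpoints, so no gap reaches either of them.
  have hint : ∀ u v, u < v → IsGap Λ u v → u ∈ Ioo (0 : I) 1 ∧ v ∈ Ioo (0 : I) 1 := by
    intro u v huv hgap
    have hv1 : v < 1 := by
      by_contra! hv
      have hlim := tendsto_iterate_one (continuous_of_mobius hF) Flt x
      obtain ⟨n, hn⟩ := (hlim.eventually_const_lt (huv.trans_le v.2.2)).exists
      obtain ⟨m1, m2⟩ := iterate_mem hF FΛ hx hxΛ n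
      rcases hgap _ m2 with k | k
      · exact k.not_gt hn
      · exact (hv.trans k).not_gt m1.2
    have hu0 : 0 < u := by
      by_contra! hu
      have hlim := tendsto_iterate_zero (continuous_of_mobius hG) Glt x
      obtain ⟨n, hn⟩ := (hlim.eventually_lt_const ((show 0 ≤ u from u.2.1).trans_lt huv)).exists
      obtain ⟨m1, m2⟩ := iterate_mem hG GΛ hx hxΛ n
      rcases hgap _ m2 with k | k
      · exact (k.trans hu).not_gt m1.1
      · exact k.not_gt hn
    exact ⟨⟨hu0, huv.trans hv1⟩, ⟨hu0.trans huv, hv1⟩⟩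
  -- The interval is a fundamental region for both pulls: neither `F` nor `G` can carry a point
  -- across it in one step.
  obtain ⟨c, d, hc0, hd1, hFc, hGd⟩ : ∃ c d : I, 0 < c ∧ d < 1 ∧ F c ≤ d ∧ c ≤ G d := by
    have i1 := mapsTo_interior hF hx
    refine ⟨min x (G (F x)), F x, lt_min hx.1 (mapsTo_interior hG i1).1, i1.2,
      Fm.monotone (min_le_left _ _), min_le_right _ _⟩
  have pull : ∀ u v, u < v → IsGap Λ u v → ∃ u' v', u' < v' ∧ IsGap Λ u' v' ∧ u' ≤ d ∧ c ≤ v' ∧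
      logit v - logit u ≤ logit v' - logit u' := by
    intro u v huv hgap
    by_cases h1 : d < u
    · exact exists_gap_pull_left hF Fm FΛ Flt hint hFc huv hgap h1
    by_cases h2 : v < c
    · exact exists_gap_pull_right hG Gm GΛ Glt hint hGd huv hgap h2
    exact ⟨u, v, huv, hgap, not_lt.1 h1, not_lt.1 h2, le_rfl⟩
  by_contra hne
  have hgap0 : ∃ u v, u < v ∧ IsGap Λ u v := by
    obtain ⟨z, hz⟩ := (ne_univ_iff_exists_notMem _).1 hne
    have hopen := hΛ.isOpen_compl
    have hdense : Dense (Ioo (0 : I) 1) := by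
      rw [dense_iff_closure_eq, closure_Ioo zero_ne_one]
      exact eq_univ_of_forall fun y => y.2
    obtain ⟨y, hy, hyΛ⟩ := hdense.exists_mem_open hopen ⟨z, hz⟩
    obtain ⟨v, hv, hsub⟩ := exists_Ico_subset_of_mem_nhds (hopen.mem_nhds hyΛ) ⟨1, hy.2⟩
    refine ⟨y, v, hv, fun w hw => ?_⟩
    by_contra! hcon
    exact hsub ⟨hcon.1.le, hcon.2⟩ hw
  -- Degenerate pairs are admitted so that `T` is closed; the maximum is positive, so it is not
  -- attained at one of them.
  let T : Set (I × I) := {p | p.1 ≤ p.2 ∧ IsGap Λ p.1 p.2 ∧ p.1 ≤ d ∧ c ≤ p.2}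
  have hgapc : IsClosed {p : I × I | IsGap Λ p.1 p.2} := by
    have e : {p : I × I | IsGap Λ p.1 p.2} = ⋂ z ∈ Λ, {p | z ≤ p.1} ∪ {p | p.2 ≤ z} := by
      ext p
      simp [IsGap]
    rw [e]
    exact isClosed_biInter fun z _ =>
      (isClosed_le continuous_const continuous_fst).union
        (isClosed_le continuous_snd continuous_const)
  have hT : IsCompact T := by
    apply IsClosed.isCompact
    exact (isClosed_le continuous_fst continuous_snd).inter (hgapc.inter
      ((isClosed_le continuous_fst continuous_const).inter
        (isClosed_le (f := fun _ : I × I => c) continuous_const continuous_snd)))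
  have hTint : ∀ p ∈ T, p.1 ∈ Ioo (0 : I) 1 ∧ p.2 ∈ Ioo (0 : I) 1 := by
    rintro ⟨u, v⟩ ⟨h1, h2, h3, h4⟩
    rcases h1.eq_or_lt with e | h
    · simp only at e h3 h4 ⊢
      subst e
      exact ⟨⟨hc0.trans_le h4, h3.trans_lt hd1⟩, ⟨hc0.trans_le h4, h3.trans_lt hd1⟩⟩
    · exact hint u v h h2
  have hcont : ContinuousOn (fun p : I × I => logit p.2 - logit p.1) T :=
    (continuousOn_logit.comp continuousOn_snd fun p hp => (hTint p hp).2).sub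
      (continuousOn_logit.comp continuousOn_fst fun p hp => (hTint p hp).1)
  obtain ⟨u₀, v₀, h₀, g₀⟩ := hgap0
  obtain ⟨u₁, v₁, h₁, g₁, a₁, b₁, -⟩ := pull u₀ v₀ h₀ g₀
  have mem₁ : (u₁, v₁) ∈ T := ⟨h₁.le, g₁, a₁, b₁⟩
  obtain ⟨⟨u, v⟩, hmem, hmax⟩ := hT.exists_isMaxOn ⟨_, mem₁⟩ hcont
  have hpos : 0 < logit v - logit u := by
    have : logit v₁ - logit u₁ ≤ logit v - logit u := hmax mem₁
    have h := logit_lt_logit (hTint _ mem₁).1 (hTint _ mem₁).2 h₁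
    simp only at h
    linarith
  have huv : u < v := by
    rcases hmem.1.eq_or_lt with e | h
    · simp only at e
      rw [e, sub_self] at hpos
      exact absurd hpos (lt_irrefl _)
    · exact h
  -- Since `b` lies in Λ, the gap is on one side of it, hence in the image of `φ` or of `ψ`.
  have step : ∃ u' v', u' < v' ∧ IsGap Λ u' v' ∧ logit v - logit u < logit v' - logit u' := by
    rcases hmem.2.1 b hb with hbu | hvb
    · obtain ⟨u', v', k1, k2, k3⟩ := exists_gap_preimage φm φΛ huv hmem.2.1 (φr hbu)
        (φr (hbu.trans huv.le))
      obtain ⟨iu, iv⟩ := hint _ _ k1 k2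
      exact ⟨u', v', k1, k2, (logit_gap_preimage hφ huv k1 iu iv k3).2 φs⟩
    · obtain ⟨u', v', k1, k2, k3⟩ := exists_gap_preimage ψm ψΛ huv hmem.2.1
        (ψr (huv.le.trans hvb)) (ψr hvb)
      obtain ⟨iu, iv⟩ := hint _ _ k1 k2
      exact ⟨u', v', k1, k2, (logit_gap_preimage hψ huv k1 iu iv k3).2 ψs⟩
  obtain ⟨u', v', k1, k2, k3⟩ := step
  obtain ⟨u'', v'', l1, l2, l3, l4, l5⟩ := pull u' v' k1 k2
  have : logit v'' - logit u'' ≤ logit v - logit u := hmax (show (u'', v'') ∈ T from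
    ⟨l1.le, l2, l3, l4⟩)
  linarith

/-! ### Composites, and necessity of the conditions -/

variable {f g : I → I} {x : I}

lemma mobius_comp (hf : IsMobiusSelfMap f) (hg : IsMobiusSelfMap g) :
    IsMobiusSelfMap (f ∘ g) := by
  obtain ⟨A, B, C, D, hd, h⟩ := hf
  obtain ⟨A', B', C', D', hd', h'⟩ := hg
  refine ⟨A * A' + B * C', A * B' + B * D', C * A' + D * C', C * B' + D * D', ?_, fun y => ?_⟩
  · have := mul_ne_zero hd hd'
    intro e; apply this; linear_combination e
  · obtain ⟨n', e'⟩ := h' y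
    obtain ⟨n, e⟩ := h (g y)
    have k : (C * A' + D * C') * (y : ℝ) + (C * B' + D * D') =
        (C * (g y) + D) * (C' * y + D') := by
      rw [e']; field_simp; ring
    have k' : (A * A' + B * C') * (y : ℝ) + (A * B' + B * D') =
        (A * (g y) + B) * (C' * y + D') := by
      rw [e']; field_simp; ring
    rw [k, k', mul_div_mul_right _ _ n']
    exact ⟨mul_ne_zero n n', e⟩

lemma comp_zero_ne_zero (hf : IsMobiusSelfMap f) (hg : IsMobiusSelfMap g) (f0 : f 0 = 1)
    (g1 : g 1 = 0) (hs : ¬ Function.Surjective (f ∘ g)) : (f ∘ g) 0 ≠ 0 := fun h =>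
  hs (surjective_of_endpoints (continuous_of_mobius (mobius_comp hf hg))
    (Or.inr ⟨h, by rw [Function.comp_apply, g1, f0]⟩))

lemma comp_one_ne_one (hf : IsMobiusSelfMap f) (hg : IsMobiusSelfMap g) (f0 : f 0 = 1)
    (g1 : g 1 = 0) (hs : ¬ Function.Surjective (g ∘ f)) : (g ∘ f) 1 ≠ 1 := fun h =>
  hs (surjective_of_endpoints (continuous_of_mobius (mobius_comp hg hf))
    (Or.inr ⟨by rw [Function.comp_apply, f0, g1], h⟩))

lemma not_surjective_comp (hf : Function.Injective f)
    (h : ¬ Function.Surjective f ∨ ¬ Function.Surjective g) : ¬ Function.Surjective (f ∘ g) :=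
  fun hs => h.elim (fun k => k hs.of_comp) fun k => k (hs.of_comp_left hf)

lemma isO_of_dense (hf : IsMobiusSelfMap f) (hg : IsMobiusSelfMap g) (hf_dec : StrictAnti f)
    (hg_dec : StrictAnti g) (hx : x ∈ Ioo (0 : I) 1) (f0 : f 0 = 1) (g1 : g 1 = 0)
    (hs : ¬ Function.Surjective f ∨ ¬ Function.Surjective g)
    (hd : Dense (semigroupOrbit f g x)) : IsO (f ∘ g) 1 ∧ IsO (g ∘ f) 0 := by
  have hF := continuous_of_mobius (mobius_comp hf hg)
  have hG := continuous_of_mobius (mobius_comp hg hf)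
  constructor
  · refine isO_one hF (lt_apply_of_no_fixed hF
      (comp_zero_ne_zero hf hg f0 g1 (not_surjective_comp hf_dec.injective hs))
      (no_fixed_of_dense hf hg hf_dec hg_dec hx hd)) ?_
    rw [Function.comp_apply, g1, f0]
  · refine isO_zero hG (apply_lt_of_no_fixed hG
      (comp_one_ne_one hf hg f0 g1 (not_surjective_comp hg_dec.injective hs.symm))
      (no_fixed_of_dense hg hf hg_dec hf_dec hx (semigroupOrbit_comm ▸ hd))) ?_
    rw [Function.comp_apply, f0, g1]

lemma range_union_of_dense (hf : IsMobiusSelfMap f) (hg : IsMobiusSelfMap g)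
    (hd : Dense (semigroupOrbit f g x)) : range f ∪ range g = univ := by
  refine eq_univ_of_dense_of_finite (t := {x})
    ((isCompact_range (continuous_of_mobius hf)).isClosed.union
      (isCompact_range (continuous_of_mobius hg)).isClosed) (finite_singleton x)
    (fun y _ => Or.inl (Or.inl (mem_range_self y)))
    (fun y _ => Or.inl (Or.inr (mem_range_self y))) (Or.inr rfl) hd

/-- As `f` is an involution, `range g = range (g ∘ f)`, and `f` exchanges the images of `f ∘ g` and
`g ∘ f`. Only `x` and `f x` can escape their union. -/
lemma range_comp_union_of_dense (hf : IsMobiusSelfMap f) (hg : IsMobiusSelfMap g)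
    (f0 : f 0 = 1) (f1 : f 1 = 0) (hd : Dense (semigroupOrbit f g x)) :
    range (f ∘ g) ∪ range (g ∘ f) = univ := by
  obtain ⟨-, hff⟩ := exists_reflection hf f0 f1
  have hgr : ∀ y, g y ∈ range (g ∘ f) := fun y => ⟨f y, by rw [Function.comp_apply, hff]⟩
  refine eq_univ_of_dense_of_finite (t := {x, f x})
    ((isCompact_range (continuous_of_mobius (mobius_comp hf hg))).isClosed.union
      (isCompact_range (continuous_of_mobius (mobius_comp hg hf))).isClosed)
    ((finite_singleton _).insert _) ?_
    (fun y _ => Or.inl (Or.inr (hgr y))) (Or.inr (Or.inl rfl)) hd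
  rintro y ((⟨z, rfl⟩ | ⟨z, rfl⟩) | (rfl | rfl))
  · rw [Function.comp_apply, hff]
    exact Or.inl (Or.inr (hgr z))
  · exact Or.inl (Or.inl ⟨f z, rfl⟩)
  · exact Or.inr (Or.inr rfl)
  · rw [hff]
    exact Or.inr (Or.inl rfl)

/-- The values 0 and 1 are both attained, but not by one map, since it would be onto. This fixes
which composite fixes which endpoint. -/
lemma exists_isO_of_dense_of_not_onto (hf : IsMobiusSelfMap f) (hg : IsMobiusSelfMap g)
    (hf_dec : StrictAnti f) (hg_dec : StrictAnti g) (hx : x ∈ Ioo (0 : I) 1)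
    (hfs : ¬ Function.Surjective f) (hgs : ¬ Function.Surjective g)
    (hd : Dense (semigroupOrbit f g x)) :
    ∃ p q : I, IsO (f ∘ g) p ∧ IsO (g ∘ f) q ∧ ({p, q} : Set I) = {0, 1} := by
  have hcov := range_union_of_dense hf hg hd
  rw [surjective_iff (continuous_of_mobius hf) hf_dec] at hfs
  rw [surjective_iff (continuous_of_mobius hg) hg_dec] at hgs
  have hs : ¬ Function.Surjective f := by
    rwa [surjective_iff (continuous_of_mobius hf) hf_dec]
  rcases hcov.symm ▸ mem_univ (0 : I) with h0 | h0
  · have f1 := apply_one_eq_zero_of_mem_range hf_dec h0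
    rcases hcov.symm ▸ mem_univ (1 : I) with h1 | h1
    · exact absurd ⟨apply_zero_eq_one_of_mem_range hf_dec h1, f1⟩ hfs
    · have g0 := apply_zero_eq_one_of_mem_range hg_dec h1
      obtain ⟨k1, k2⟩ := isO_of_dense hg hf hg_dec hf_dec hx g0 f1 (Or.inr hs)
        (semigroupOrbit_comm ▸ hd)
      exact ⟨0, 1, k2, k1, rfl⟩
  · have g1 := apply_one_eq_zero_of_mem_range hg_dec h0
    rcases hcov.symm ▸ mem_univ (1 : I) with h1 | h1
    · have f0 := apply_zero_eq_one_of_mem_range hf_dec h1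
      obtain ⟨k1, k2⟩ := isO_of_dense hf hg hf_dec hg_dec hx f0 g1 (Or.inl hs) hd
      exact ⟨1, 0, k1, k2, pair_comm _ _⟩
    · exact absurd ⟨apply_zero_eq_one_of_mem_range hg_dec h1, g1⟩ hgs

/-- If `f` is onto and the images of `f ∘ g` and `g ∘ f` cover `[0,1]`, then `g` attains `0` at
`1` or `1` at `0`. -/
lemma endpoints_of_range_comp_union (hf_dec : StrictAnti f) (hg_dec : StrictAnti g)
    (f1 : f 1 = 0) (hcov : range (f ∘ g) ∪ range (g ∘ f) = univ) : g 1 = 0 ∨ g 0 = 1 := by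
  rcases hcov.symm ▸ mem_univ (0 : I) with ⟨y, hy⟩ | ⟨y, hy⟩
  · right
    rw [Function.comp_apply, ← f1] at hy
    exact apply_zero_eq_one_of_mem_range hg_dec ⟨y, hf_dec.injective hy⟩
  · left
    exact apply_one_eq_zero_of_mem_range hg_dec ⟨f y, hy⟩

lemma exists_isO_of_dense_of_onto (hf : IsMobiusSelfMap f) (hg : IsMobiusSelfMap g)
    (hf_dec : StrictAnti f) (hg_dec : StrictAnti g) (hx : x ∈ Ioo (0 : I) 1)
    (hfs : Function.Surjective f) (hgs : ¬ Function.Surjective g)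
    (hd : Dense (semigroupOrbit f g x)) :
    (∃ p q : I, IsO (f ∘ g) p ∧ IsO (g ∘ f) q ∧ ({p, q} : Set I) = {0, 1}) ∧
      range (f ∘ g) ∪ range (g ∘ f) = univ := by
  obtain ⟨f0, f1⟩ := (surjective_iff (continuous_of_mobius hf) hf_dec).1 hfs
  have hcov := range_comp_union_of_dense hf hg f0 f1 hd
  refine ⟨?_, hcov⟩
  rcases endpoints_of_range_comp_union hf_dec hg_dec f1 hcov with g1 | g0
  · obtain ⟨k1, k2⟩ := isO_of_dense hf hg hf_dec hg_dec hx f0 g1 (Or.inr hgs) hd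
    exact ⟨1, 0, k1, k2, pair_comm _ _⟩
  · obtain ⟨k1, k2⟩ := isO_of_dense hg hf hg_dec hf_dec hx g0 f1 (Or.inl hgs)
      (semigroupOrbit_comm ▸ hd)
    exact ⟨0, 1, k2, k1, rfl⟩

/-! ### Sufficiency of the conditions -/

/-- A point to the right of an interior fixed point cannot move farther from it, so its iterates
stay bounded away from 1. -/
lemma no_fixed_of_isO_one {F : I → I} (hF : IsMobiusSelfMap F) (hm : StrictMono F)
    (hO : IsO F 1) : ∀ u ∈ Ioo (0 : I) 1, F u ≠ u := by
  intro u hu hfix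
  have hmem : ∀ᶠ y in 𝓝[<] (1 : I), y ∈ Ioo u 1 := Ioo_mem_nhdsLT hu.2
  have hev : ∀ᶠ y in 𝓝[<] (1 : I), Tendsto (fun n : ℕ => F^[n] y) atTop (𝓝 1) :=
    hO.1.2.filter_mono nhdsWithin_le_nhds
  have hne : (𝓝[<] (1 : I)).NeBot := nhdsLT_neBot_of_exists_lt ⟨0, zero_lt_one⟩
  obtain ⟨y, hlim, hy⟩ := (hev.and hmem).exists
  have hy' : y ∈ Ioo (0 : I) 1 := ⟨hu.1.trans hy.1, hy.2⟩
  have hFy : F y ≤ y := by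
    by_contra! h
    have k1 := (dist_logit_of_lt hF hu hy' hy.1).1
    have k2 := logit_lt_logit hy' (mapsTo_interior hF hy') h
    rw [hfix] at k1
    have k3 := neg_abs_le (logit u - logit (F y))
    linarith
  have hle : ∀ n : ℕ, F^[n] y ≤ y := by
    intro n
    induction n with
    | zero => exact le_rfl
    | succ n ih =>
      rw [Function.iterate_succ_apply']
      exact (hm.monotone ih).trans hFy
  exact (le_of_tendsto' hlim hle).not_gt hy.2

lemma lt_apply_of_exists_isO (hf : IsMobiusSelfMap f) (hg : IsMobiusSelfMap g)
    (hf_dec : StrictAnti f) (hg_dec : StrictAnti g) (f0 : f 0 = 1) (g1 : g 1 = 0)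
    (hs : ¬ Function.Surjective f ∨ ¬ Function.Surjective g)
    (hO : ∃ p q : I, IsO (f ∘ g) p ∧ IsO (g ∘ f) q ∧ ({p, q} : Set I) = {0, 1}) :
    (∀ y < 1, y < (f ∘ g) y) ∧ ∀ y > 0, (g ∘ f) y < y := by
  obtain ⟨p, q, hp, -, hpq⟩ := hO
  have hF0 := comp_zero_ne_zero hf hg f0 g1 (not_surjective_comp hf_dec.injective hs)
  have hG1 := comp_one_ne_one hf hg f0 g1 (not_surjective_comp hg_dec.injective hs.symm)
  have hp1 : p = 1 := by
    have : p ∈ ({0, 1} : Set I) := hpq ▸ mem_insert _ _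
    rcases this with rfl | h
    · exact absurd hp.1.1 hF0
    · exact h
  subst hp1
  have hfix := no_fixed_of_isO_one (mobius_comp hf hg) (hf_dec.comp hg_dec) hp
  refine ⟨lt_apply_of_no_fixed (continuous_of_mobius (mobius_comp hf hg)) hF0 hfix,
    apply_lt_of_no_fixed (continuous_of_mobius (mobius_comp hg hf)) hG1 fun w hw h => ?_⟩
  -- `f` carries fixed points of `g ∘ f` to fixed points of `f ∘ g`.
  exact hfix (f w) (mapsTo_interior hf hw) (congrArg f h)

/-- The images are an interval ending at 1 and an interval starting at 0. They cover only if they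
overlap, and `ψ M` is then a splitting point in both. -/
lemma Ici_subset_range_of_cover {φ ψ : I → I} (hφ : Continuous φ) (hψ : Continuous ψ)
    {e m e' M : I} (he : φ e = 1) (hm : ∀ y, φ m ≤ φ y) (he' : ψ e' = 0)
    (hM : ∀ y, ψ y ≤ ψ M) (hcov : range φ ∪ range ψ = univ) :
    Ici (ψ M) ⊆ range φ ∧ Iic (ψ M) ⊆ range ψ := by
  have hle : φ m ≤ ψ M := by
    by_contra! h
    obtain ⟨z, h1, h2⟩ := exists_between h
    rcases hcov.symm ▸ mem_univ z with ⟨y, rfl⟩ | ⟨y, rfl⟩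
    · exact (hm y).not_gt h2
    · exact (hM y).not_gt h1
  exact ⟨fun y hy => mem_range_of_exists_le_of_exists_ge hφ ⟨m, hle.trans hy⟩
      ⟨e, he.symm ▸ unitInterval.le_one'⟩,
    fun y hy => mem_range_of_exists_le_of_exists_ge hψ
      ⟨e', he'.symm ▸ unitInterval.nonneg'⟩ ⟨M, hy⟩⟩

lemma dense_of_exists_isO (hf : IsMobiusSelfMap f) (hg : IsMobiusSelfMap g)
    (hf_dec : StrictAnti f) (hg_dec : StrictAnti g) (hx : x ∈ Ioo (0 : I) 1) (f0 : f 0 = 1)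
    (g1 : g 1 = 0) (hs : ¬ Function.Surjective f ∨ ¬ Function.Surjective g)
    (hO : ∃ p q : I, IsO (f ∘ g) p ∧ IsO (g ∘ f) q ∧ ({p, q} : Set I) = {0, 1})
    (hcov : (¬ Function.Surjective f ∧ ¬ Function.Surjective g ∧ range f ∪ range g = univ) ∨
      range (f ∘ g) ∪ range (g ∘ f) = univ) :
    Dense (semigroupOrbit f g x) := by
  obtain ⟨Flt, Glt⟩ := lt_apply_of_exists_isO hf hg hf_dec hg_dec f0 g1 hs hO
  have fc := continuous_of_mobius hf
  have gc := continuous_of_mobius hg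
  have hF := mobius_comp hf hg
  have hG := mobius_comp hg hf
  have fΛ := (mapsTo_left_semigroupOrbit (f := f) (g := g) (x := x)).closure fc
  have gΛ := (mapsTo_right_semigroupOrbit (f := f) (g := g) (x := x)).closure gc
  -- The semigroup has no identity adjoined, so `x` itself may be missing from its orbit; `f x`
  -- serves as the base point.
  have hmem : f x ∈ closure (semigroupOrbit f g x) :=
    subset_closure left_apply_mem_semigroupOrbit
  -- With 0 in the closure, so is the splitting point: `g 0` in the first case, and `g (f 1)` with
  -- `1 = f 0` in the second.
  have h0 : (0 : I) ∈ closure (semigroupOrbit f g x) :=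
    isClosed_closure.mem_of_tendsto (tendsto_iterate_zero (continuous_of_mobius hG) Glt (f x))
      (.of_forall fun n => (gΛ.comp fΛ).iterate n hmem)
  rw [dense_iff_closure_eq]
  rcases hcov with ⟨hfs, hgs, hcov⟩ | hcov
  · obtain ⟨r1, r2⟩ := Ici_subset_range_of_cover fc gc f0
      (fun y => hf_dec.antitone (unitInterval.le_one' : y ≤ 1)) g1
      (fun y => hg_dec.antitone (unitInterval.nonneg' : 0 ≤ y)) hcov
    exact eq_univ_of_invariant isClosed_closure hf hg hF hG fΛ gΛ (fΛ.comp gΛ) (gΛ.comp fΛ)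
      (Or.inr hf_dec) (Or.inr hg_dec) (hf_dec.comp hg_dec) (hg_dec.comp hf_dec) hfs hgs (gΛ h0)
      r1 r2 Flt Glt (mapsTo_interior hf hx) hmem
  · have Fm := hf_dec.comp hg_dec
    have Gm := hg_dec.comp hf_dec
    obtain ⟨r1, r2⟩ := Ici_subset_range_of_cover (fc.comp gc) (gc.comp fc) (e := 1) (e' := 0)
      (by rw [Function.comp_apply, g1, f0])
      (fun y => Fm.monotone (unitInterval.nonneg' : 0 ≤ y))
      (by rw [Function.comp_apply, f0, g1])
      (fun y => Gm.monotone (unitInterval.le_one' : y ≤ 1)) hcov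
    have h1 : (1 : I) ∈ closure (semigroupOrbit f g x) := f0 ▸ fΛ h0
    exact eq_univ_of_invariant isClosed_closure hF hG hF hG (fΛ.comp gΛ) (gΛ.comp fΛ)
      (fΛ.comp gΛ) (gΛ.comp fΛ) (Or.inl Fm) (Or.inl Gm) Fm Gm
      (not_surjective_comp hf_dec.injective hs) (not_surjective_comp hg_dec.injective hs.symm)
      (gΛ (fΛ h1)) r1 r2 Flt Glt (mapsTo_interior hf hx) hmem

lemma exists_isO_swap
    (hO : ∃ p q : I, IsO (f ∘ g) p ∧ IsO (g ∘ f) q ∧ ({p, q} : Set I) = {0, 1}) :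
    ∃ p q : I, IsO (g ∘ f) p ∧ IsO (f ∘ g) q ∧ ({p, q} : Set I) = {0, 1} := by
  obtain ⟨p, q, hp, hq, h⟩ := hO
  exact ⟨q, p, hq, hp, pair_comm p q ▸ h⟩

lemma dense_of_not_onto (hf : IsMobiusSelfMap f) (hg : IsMobiusSelfMap g)
    (hf_dec : StrictAnti f) (hg_dec : StrictAnti g) (hx : x ∈ Ioo (0 : I) 1)
    (hO : ∃ p q : I, IsO (f ∘ g) p ∧ IsO (g ∘ f) q ∧ ({p, q} : Set I) = {0, 1})
    (hfs : ¬ Function.Surjective f) (hgs : ¬ Function.Surjective g)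
    (hcov : range f ∪ range g = univ) : Dense (semigroupOrbit f g x) := by
  have hfs' := hfs
  have hgs' := hgs
  rw [surjective_iff (continuous_of_mobius hf) hf_dec] at hfs'
  rw [surjective_iff (continuous_of_mobius hg) hg_dec] at hgs'
  rcases hcov.symm ▸ mem_univ (0 : I) with h0 | h0
  · have f1 := apply_one_eq_zero_of_mem_range hf_dec h0
    rcases hcov.symm ▸ mem_univ (1 : I) with h1 | h1
    · exact absurd ⟨apply_zero_eq_one_of_mem_range hf_dec h1, f1⟩ hfs'
    · rw [semigroupOrbit_comm]
      exact dense_of_exists_isO hg hf hg_dec hf_dec hx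
        (apply_zero_eq_one_of_mem_range hg_dec h1) f1 (Or.inl hgs) (exists_isO_swap hO)
        (Or.inl ⟨hgs, hfs, union_comm _ _ ▸ hcov⟩)
  · have g1 := apply_one_eq_zero_of_mem_range hg_dec h0
    rcases hcov.symm ▸ mem_univ (1 : I) with h1 | h1
    · exact dense_of_exists_isO hf hg hf_dec hg_dec hx
        (apply_zero_eq_one_of_mem_range hf_dec h1) g1 (Or.inl hfs) hO
        (Or.inl ⟨hfs, hgs, hcov⟩)
    · exact absurd ⟨apply_zero_eq_one_of_mem_range hg_dec h1, g1⟩ hgs'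

lemma dense_of_onto (hf : IsMobiusSelfMap f) (hg : IsMobiusSelfMap g)
    (hf_dec : StrictAnti f) (hg_dec : StrictAnti g) (hx : x ∈ Ioo (0 : I) 1)
    (hO : ∃ p q : I, IsO (f ∘ g) p ∧ IsO (g ∘ f) q ∧ ({p, q} : Set I) = {0, 1})
    (hfs : Function.Surjective f) (hgs : ¬ Function.Surjective g)
    (hcov : range (f ∘ g) ∪ range (g ∘ f) = univ) : Dense (semigroupOrbit f g x) := by
  obtain ⟨f0, f1⟩ := (surjective_iff (continuous_of_mobius hf) hf_dec).1 hfs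
  rcases endpoints_of_range_comp_union hf_dec hg_dec f1 hcov with g1 | g0
  · exact dense_of_exists_isO hf hg hf_dec hg_dec hx f0 g1 (Or.inr hgs) hO (Or.inr hcov)
  · rw [semigroupOrbit_comm]
    exact dense_of_exists_isO hg hf hg_dec hf_dec hx g0 f1 (Or.inl hgs) (exists_isO_swap hO)
      (Or.inr (union_comm _ _ ▸ hcov))

end MobiusOrbit

theorem mainTheorem4 (f g : unitInterval → unitInterval)
    (hf : IsMobiusSelfMap f) (hg : IsMobiusSelfMap g)
    (hf_dec : StrictAnti f) (hg_dec : StrictAnti g)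
    (x : unitInterval) (hx : x ∈ Set.Ioo (0 : unitInterval) 1) :
    Dense (semigroupOrbit f g x) ↔
      (∃ p q : unitInterval, IsO (f ∘ g) p ∧ IsO (g ∘ f) q ∧
        ({p, q} : Set unitInterval) = {0, 1}) ∧
      ((¬ Function.Surjective f ∧ ¬ Function.Surjective g ∧
          Set.range f ∪ Set.range g = Set.univ) ∨
        (Xor (Function.Surjective f) (Function.Surjective g) ∧
          Set.range (f ∘ g) ∪ Set.range (g ∘ f) = Set.univ)) := by
  constructor
  · intro hd
    have hd' : Dense (semigroupOrbit g f x) := MobiusOrbit.semigroupOrbit_comm ▸ hd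
    by_cases hfs : Function.Surjective f <;> by_cases hgs : Function.Surjective g
    · obtain ⟨f0, f1⟩ :=
        (MobiusOrbit.surjective_iff (MobiusOrbit.continuous_of_mobius hf) hf_dec).1 hfs
      obtain ⟨g0, g1⟩ :=
        (MobiusOrbit.surjective_iff (MobiusOrbit.continuous_of_mobius hg) hg_dec).1 hgs
      exact absurd hd (MobiusOrbit.not_dense_of_onto hf hg f0 f1 g0 g1 hx)
    · obtain ⟨hO, hcov⟩ :=
        MobiusOrbit.exists_isO_of_dense_of_onto hf hg hf_dec hg_dec hx hfs hgs hd
      exact ⟨hO, Or.inr ⟨Or.inl ⟨hfs, hgs⟩, hcov⟩⟩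
    · obtain ⟨hO, hcov⟩ :=
        MobiusOrbit.exists_isO_of_dense_of_onto hg hf hg_dec hf_dec hx hgs hfs hd'
      exact ⟨MobiusOrbit.exists_isO_swap hO,
        Or.inr ⟨Or.inr ⟨hgs, hfs⟩, union_comm _ _ ▸ hcov⟩⟩
    · exact ⟨MobiusOrbit.exists_isO_of_dense_of_not_onto hf hg hf_dec hg_dec hx hfs hgs hd,
        Or.inl ⟨hfs, hgs, MobiusOrbit.range_union_of_dense hf hg hd⟩⟩
  · rintro ⟨hO, ⟨hfs, hgs, hcov⟩ | ⟨⟨hfs, hgs⟩ | ⟨hgs, hfs⟩, hcov⟩⟩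
    · exact MobiusOrbit.dense_of_not_onto hf hg hf_dec hg_dec hx hO hfs hgs hcov
    · exact MobiusOrbit.dense_of_onto hf hg hf_dec hg_dec hx hO hfs hgs hcov
    · rw [MobiusOrbit.semigroupOrbit_comm]
      exact MobiusOrbit.dense_of_onto hg hf hg_dec hf_dec hx (MobiusOrbit.exists_isO_swap hO)
        hgs hfs (union_comm _ _ ▸ hcov)
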